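/- For $x\in\mathbb{R}^N$ let $Dx\in\mathbb{R}^{N-1}$ be the finite difference $(Dx)_i=x_{i+1}-x_i$, $1\le i\le N-1$, and for $\mathcal K\subseteq\{1,\dots,N-1\}$ let $(Dx)_{\mathcal K^c}$ be the restriction of $Dx$ to $\mathcal K^c=\{1,\dots,N-1\}\setminus\mathcal K$. **Theorem.** For all constants $0<\alpha<1$ and $0<C<1$ there exist constants $\delta>0$ and $\beta>0$ (depending only on $\alpha$ and $C$) such that the following holds. Let $A$ be an $M\times N$ random matrix with i.i.d. standard Gaussian $\mathcal N(0,1)$ entries. Then, as $M\to\infty$, $N\to\infty$ and $M/N\to\alpha$, with overwhelming probability (that is, with failure probability at most $e^{-cN}$ for all sufficiently large $N$, where $c>0$ depends only on $\alpha$ and $C$), simultaneously for all $x\in\mathbb{R}^N$, $y\in\mathbb{R}^M$ and $\epsilon$ with $\|Ax-y\|_2\le\epsilon$, every solution $\hat x$ of $$\min_{z\in\mathbb{R}^N}\ \|Dz\|_1\quad\text{subject to}\quad \|Az-y\|_2\le\epsilon$$ satisfies $$\|x-\hat x\|_2\le \frac{2(1+C)}{\beta(1-C)}\cdot\frac{\min_{|\mathcal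 K|\le\delta N}\|(Dx)_{\mathcal K^c}\|_1}{\sqrt N}+\left(2+\frac{4(1+C)}{\beta(1-C)}\right)\frac{\epsilon}{\sqrt N-\sqrt M}.$$ -/

import Mathlib

open MeasureTheory ProbabilityTheory Filter Topology

/-- The finite difference of a one-dimensional signal `x ∈ ℝ^N`: `(D x)_i = x_{i+1} - x_i` for the
`N - 1` consecutive pairs of indices. -/
def finiteDiff {N : ℕ} (x : EuclideanSpace ℝ (Fin N)) (i : Fin (N - 1)) : ℝ :=
  x ⟨i.val + 1, by omega⟩ - x ⟨i.val, by omega⟩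

/-- The total variation `‖D x‖₁`. -/
def tvNorm {N : ℕ} (x : EuclideanSpace ℝ (Fin N)) : ℝ :=
  ∑ i, |finiteDiff x i|

/-- `min_{|K| ≤ s} ‖(D x)_{K^c}‖₁`, over index sets `K` of gradient coordinates. For `s ≥ 0` this is
the minimum of a nonempty finite family. -/
noncomputable def bestGradientError {N : ℕ} (s : ℝ) (x : EuclideanSpace ℝ (Fin N)) : ℝ :=
  ⨅ K : {K : Finset (Fin (N - 1)) // (K.card : ℝ) ≤ s}, ∑ i ∈ (K.val)ᶜ, |finiteDiff x i|

/-- The feasible set `{z | ‖A z - y‖₂ ≤ ε}` of the noise-constrained program. -/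
def tvFeasible {M N : ℕ} (A : Matrix (Fin M) (Fin N) ℝ) (y : EuclideanSpace ℝ (Fin M)) (ε : ℝ) :
    Set (EuclideanSpace ℝ (Fin N)) :=
  {z | ‖Matrix.toEuclideanLin A z - y‖ ≤ ε}

/-- `xhat` solves `min ‖D z‖₁` subject to `‖A z - y‖₂ ≤ ε`. -/
def IsTVSolution {M N : ℕ} (A : Matrix (Fin M) (Fin N) ℝ) (y : EuclideanSpace ℝ (Fin M)) (ε : ℝ)
    (xhat : EuclideanSpace ℝ (Fin N)) : Prop :=
  xhat ∈ tvFeasible A y ε ∧ IsMinOn tvNorm (tvFeasible A y ε) xhat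

/-- The random matrix `A` has i.i.d. standard Gaussian entries. -/
structure IsStdGaussianMatrix {Ω : Type*} [MeasurableSpace Ω] {M N : ℕ}
    (A : Ω → Matrix (Fin M) (Fin N) ℝ) (P : Measure Ω) : Prop where
  hasLaw : ∀ i j, HasLaw (fun ω => A ω i j) (gaussianReal 0 1) P
  indep : iIndepFun (fun (p : Fin M × Fin N) ω => A ω p.1 p.2) P

/-- The recovery guarantee with parameters `C, δ, β`, for all signals, all measurement vectors, all
noise levels and all solutions of the noise-constrained program. -/
def RobustTVRecovery (C δ β : ℝ) {M N : ℕ} (A : Matrix (Fin M) (Fin N) ℝ) : Prop :=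
  ∀ (x : EuclideanSpace ℝ (Fin N)) (y : EuclideanSpace ℝ (Fin M)) (ε : ℝ),
    ‖Matrix.toEuclideanLin A x - y‖ ≤ ε →
    ∀ xhat : EuclideanSpace ℝ (Fin N), IsTVSolution A y ε xhat →
      ‖x - xhat‖ ≤
        (2 * (1 + C) / (β * (1 - C))) * (bestGradientError (δ * N) x / Real.sqrt N) +
        (2 + 4 * (1 + C) / (β * (1 - C))) * (ε / (Real.sqrt N - Real.sqrt M))

/-!
The difference `h = x - x̂` of the signal and a solution satisfies `‖A h‖ ≤ 2 ε`. Since `x̂` has no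
larger total variation than `x`, for an index set `K` of size at most `δ N` attaining the best
gradient error `σ`,
`‖D h‖₁ ≤ 2 ‖(D h)_K‖₁ + 2 σ ≤ 4 √(δ N) ‖h‖ + 2 σ`.
Hence either `√N ‖h‖` is at most a constant times `σ`, or `‖D h‖₁ ≤ γ √N ‖h‖` with `γ` small. In the
second case it is enough to know that, with overwhelming probability, `‖A h‖ ≥ κ √N ‖h‖` for all
signals `h` with `‖D h‖₁ ≤ γ √N ‖h‖` (`robustTVRecovery_of_le_norm`). Since `√N - √M ≤ √N` and `β` may
be chosen small, the constants of the error bound take care of themselves.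

The lower bound on `‖A h‖` comes from a net. Scaled to norm `√N / η`, the signal `h` lies within
distance `1`, coordinatewise, of an integer signal `q` whose increments have `ℓ¹` norm at most a small
multiple of `N` (`exists_int_increments`). There are at most `exp (ψ N)` such signals, where `ψ` is as
small as desired (`exists_card_intL1Ball_le`), whereas `‖A q‖² < (M / 4) ‖q‖²` has probability at most
`exp (-M / 4)` for each of them, by the Laplace transform of the chi-square distribution
(`IsStdGaussianMatrix.measure_normSq_mulVec_lt`). The rounding error lies in the cube `[-1, 1] ^ N`,
where the convex function `‖A ·‖` is maximal at one of the `2 ^ N` vertices; all vertices are mapped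
into the ball of radius `4 N` with overwhelming probability. For small `η` the rounding error is
therefore dominated by `‖A q‖` (`WellConditionedOnNet.le_norm`).
-/

/-! ### Gaussian matrices applied to a fixed vector -/

namespace IsStdGaussianMatrix

variable {Ω : Type*} [MeasurableSpace Ω] {P : Measure Ω} {M N : ℕ}
  {A : Ω → Matrix (Fin M) (Fin N) ℝ}

lemma covariance_entries (hA : IsStdGaussianMatrix A P) (i i' : Fin M) (j j' : Fin N) :
    cov[fun ω => A ω i j, fun ω => A ω i' j'; P] = if i = i' ∧ j = j' then 1 else 0 := by
  have hmem (i j) : MemLp (fun ω => A ω i j) 2 P := (hA.hasLaw i j).hasGaussianLaw.memLp_two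
  split_ifs with h
  · obtain ⟨rfl, rfl⟩ := h
    rw [covariance_self (hA.hasLaw i j).aemeasurable, (hA.hasLaw i j).variance_eq,
      variance_id_gaussianReal, NNReal.coe_one]
  · have hne : (i, j) ≠ (i', j') := by simpa [Prod.ext_iff] using h
    exact (hA.indep.indepFun hne).covariance_eq_zero (hmem i j) (hmem i' j')

lemma covariance_mulVec (hA : IsStdGaussianMatrix A P) (u : Fin N → ℝ) (i i' : Fin M) :
    cov[fun ω => (A ω).mulVec u i, fun ω => (A ω).mulVec u i'; P] =
      if i = i' then ∑ j, u j ^ 2 else 0 := by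
  have := hA.indep.isProbabilityMeasure
  have hmem (i j) : MemLp (fun ω => A ω i j * u j) 2 P :=
    (hA.hasLaw i j).hasGaussianLaw.memLp_two.mul_const _
  simp only [Matrix.mulVec, dotProduct]
  rw [covariance_fun_sum_fun_sum (fun j => hmem i j) (fun j => hmem i' j)]
  simp only [covariance_mul_const_left, covariance_mul_const_right, hA.covariance_entries]
  by_cases h : i = i' <;> simp [h, pow_two]

lemma hasGaussianLaw_mulVec (hA : IsStdGaussianMatrix A P) (u : Fin N → ℝ) :
    HasGaussianLaw (fun ω i => (A ω).mulVec u i) P := by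
  have hjoint : HasGaussianLaw (fun ω (p : Fin M × Fin N) => A ω p.1 p.2) P :=
    iIndepFun.hasGaussianLaw (fun p => (hA.hasLaw p.1 p.2).hasGaussianLaw) hA.indep
  let L : (Fin M × Fin N → ℝ) →L[ℝ] (Fin M → ℝ) :=
    ContinuousLinearMap.pi fun i => ∑ j, u j • ContinuousLinearMap.proj (i, j)
  convert! hjoint.map_fun L using 1
  ext ω i
  simp [L, Matrix.mulVec, dotProduct, mul_comm]

lemma hasLaw_mulVec (hA : IsStdGaussianMatrix A P) (u : Fin N → ℝ) (i : Fin M) :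
    HasLaw (fun ω => (A ω).mulVec u i) (gaussianReal 0 (∑ j, u j ^ 2).toNNReal) P := by
  have hG : HasGaussianLaw (fun ω => (A ω).mulVec u i) P := (hA.hasGaussianLaw_mulVec u).eval i
  refine ⟨hG.aemeasurable, ?_⟩
  have hint (j) : Integrable (fun ω => A ω i j * u j) P :=
    ((hA.hasLaw i j).hasGaussianLaw.integrable).mul_const _
  have hmean : P[fun ω => (A ω).mulVec u i] = 0 := by
    simp only [Matrix.mulVec, dotProduct]
    rw [integral_finsetSum _ fun j _ => hint j]
    refine Finset.sum_eq_zero fun j _ => ?_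
    rw [integral_mul_const, (hA.hasLaw i j).integral_eq, integral_id_gaussianReal, zero_mul]
  have hvar : Var[fun ω => (A ω).mulVec u i; P] = ∑ j, u j ^ 2 := by
    rw [← covariance_self hG.aemeasurable, hA.covariance_mulVec, if_pos rfl]
  rw [hG.map_eq_gaussianReal, hmean, hvar]

lemma iIndepFun_mulVec (hA : IsStdGaussianMatrix A P) (u : Fin N → ℝ) :
    iIndepFun (fun i ω => (A ω).mulVec u i) P :=
  (hA.hasGaussianLaw_mulVec u).iIndepFun_of_covariance_eq_zero fun i i' h => by
    rw [hA.covariance_mulVec, if_neg h]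

end IsStdGaussianMatrix

/-- The moment generating function of the square of a centred Gaussian of variance `v`. -/
lemma mgf_sq_gaussianReal {v : NNReal} (hv : v ≠ 0) {t : ℝ} (ht : 2 * t * v < 1) :
    mgf (fun x => x ^ 2) (gaussianReal 0 v) t = (√(1 - 2 * t * v))⁻¹ := by
  have hv' : (0 : ℝ) < v := by positivity
  rw [mgf, integral_gaussianReal_eq_integral_smul hv]
  have h : ∀ x : ℝ, gaussianPDFReal 0 v x • Real.exp (t * x ^ 2) =
      (√(2 * Real.pi * v))⁻¹ * Real.exp (-((1 - 2 * t * v) / (2 * v)) * x ^ 2) := by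
    intro x
    rw [gaussianPDFReal, smul_eq_mul, mul_assoc, ← Real.exp_add]
    congr 2
    field_simp
    ring
  simp_rw [h]
  rw [integral_const_mul, integral_gaussian, ← Real.sqrt_inv, ← Real.sqrt_inv, ← Real.sqrt_mul
    (by positivity)]
  congr 1
  have : 1 - 2 * t * v ≠ 0 := by linarith
  field_simp

namespace IsStdGaussianMatrix

variable {Ω : Type*} [MeasurableSpace Ω] {P : Measure Ω} {M N : ℕ}
  {A : Ω → Matrix (Fin M) (Fin N) ℝ}

/-- For a fixed `u`, the variable `‖A u‖²` is `‖u‖²` times a chi-square variable with `M` degrees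
of freedom. -/
lemma mgf_normSq_mulVec (hA : IsStdGaussianMatrix A P) {u : Fin N → ℝ} {v t : ℝ} (hv : 0 < v)
    (hu : ∑ j, u j ^ 2 = v) (ht : 2 * t < 1) :
    mgf (fun ω => ∑ i, (A ω).mulVec u i ^ 2) P (t / v) = (√(1 - 2 * t))⁻¹ ^ M := by
  have hv' : v.toNNReal ≠ 0 := by simpa using hv
  have hcoe : 2 * (t / v) * (v.toNNReal : ℝ) = 2 * t := by
    rw [Real.coe_toNNReal _ hv.le]; field_simp
  have hmeas (i) : AEMeasurable (fun ω => (A ω).mulVec u i ^ 2) P :=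
    (hA.hasLaw_mulVec u i).aemeasurable.pow_const 2
  have hind : iIndepFun (fun i ω => (A ω).mulVec u i ^ 2) P :=
    (hA.iIndepFun_mulVec u).comp (fun _ x => x ^ 2) fun _ => by fun_prop
  have h := hind.mgf_sum₀ (t := t / v) hmeas Finset.univ
  have hsum : (∑ i, fun ω => (A ω).mulVec u i ^ 2) = fun ω => ∑ i, (A ω).mulVec u i ^ 2 := by
    ext ω; simp
  rw [hsum] at h
  rw [h, Finset.prod_congr rfl fun i _ => ?_, Finset.prod_const, Finset.card_univ,
    Fintype.card_fin]
  have := hA.hasLaw_mulVec u i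
  rw [hu] at this
  rw [← hcoe, ← mgf_sq_gaussianReal hv' (by rwa [hcoe]), ← this.map_eq]
  refine (mgf_map (X := fun x => x ^ 2) this.aemeasurable ?_).symm
  exact (by fun_prop : Measurable fun x : ℝ => Real.exp (t / v * x ^ 2)).aestronglyMeasurable

lemma integrable_exp_normSq_mulVec [IsProbabilityMeasure P] (hA : IsStdGaussianMatrix A P)
    {u : Fin N → ℝ} {v t : ℝ} (hv : 0 < v) (hu : ∑ j, u j ^ 2 = v) (ht : 2 * t < 1) :
    Integrable (fun ω => Real.exp (t / v * ∑ i, (A ω).mulVec u i ^ 2)) P := by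
  by_contra h
  have h0 := mgf_undef h
  rw [hA.mgf_normSq_mulVec hv hu ht] at h0
  have : 0 < √(1 - 2 * t) := Real.sqrt_pos.2 (by linarith)
  exact (pow_pos (inv_pos.2 this) M).ne' h0

/-- A Gaussian matrix rarely shrinks a fixed vector: `‖A u‖² < (M / 4) ‖u‖²` has probability at
most `e ^ (-M / 4)`. -/
lemma measure_normSq_mulVec_lt [IsProbabilityMeasure P] (hA : IsStdGaussianMatrix A P)
    (u : Fin N → ℝ) :
    P.real {ω | ∑ i, (A ω).mulVec u i ^ 2 < M / 4 * ∑ j, u j ^ 2} ≤ Real.exp (-(M / 4)) := by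
  have hv0 : 0 ≤ ∑ j, u j ^ 2 := by positivity
  rcases hv0.eq_or_lt with h0 | hv
  · have : {ω | ∑ i, (A ω).mulVec u i ^ 2 < M / 4 * ∑ j, u j ^ 2} = ∅ := by
      ext ω
      simp only [← h0, mul_zero, Set.mem_ofPred_eq, Set.mem_empty_iff_false, iff_false, not_lt]
      positivity
    rw [this, measureReal_empty]
    positivity
  set v := ∑ j, u j ^ 2 with hu
  have hchern := measure_le_le_exp_mul_mgf (μ := P) (t := (-1) / v) (M / 4 * v)
    (div_nonpos_of_nonpos_of_nonneg (by norm_num) hv0)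
    (hA.integrable_exp_normSq_mulVec hv hu.symm (by norm_num))
  rw [hA.mgf_normSq_mulVec hv hu.symm (by norm_num)] at hchern
  refine (measureReal_mono fun ω hω => ?_).trans (hchern.trans ?_)
  · exact le_of_lt (Set.mem_ofPred_eq ▸ hω)
  have hexp : Real.exp (-(-1 / v) * (M / 4 * v)) = Real.exp (1 / 4) ^ M := by
    rw [← Real.exp_nat_mul]; congr 1; field_simp
  have hexp' : Real.exp (-(M / 4 : ℝ)) = Real.exp (-(1 / 4)) ^ M := by
    rw [← Real.exp_nat_mul]; congr 1; ring
  rw [hexp, hexp', ← mul_pow]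
  gcongr
  -- the inequality `exp (1 / 4) / √3 ≤ exp (-1 / 4)` amounts to `e ≤ 3`
  have h3 : Real.exp (1 / 2) ≤ √(1 - 2 * (-1)) := by
    apply Real.le_sqrt_of_sq_le
    rw [← Real.exp_nat_mul]
    norm_num
    exact Real.exp_one_lt_three.le
  rw [← div_eq_mul_inv, div_le_iff₀ (by positivity)]
  calc Real.exp (1 / 4) = Real.exp (-(1 / 4)) * Real.exp (1 / 2) := by
        rw [← Real.exp_add]; norm_num
    _ ≤ _ := by gcongr

/-- A Gaussian matrix rarely stretches a fixed vector `u` of norm `√N`: `‖A u‖ ≥ 4 N` has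
probability at most `e ^ (-3 N)`, which is small enough for a union bound over `2 ^ N` vectors. -/
lemma measure_le_normSq_mulVec [IsProbabilityMeasure P] (hA : IsStdGaussianMatrix A P)
    (hMN : M ≤ N) {u : Fin N → ℝ} (hu : ∑ j, u j ^ 2 = N) (hN : 0 < N) :
    P.real {ω | (4 * N : ℝ) ^ 2 ≤ ∑ i, (A ω).mulVec u i ^ 2} ≤ Real.exp (-3 * N) := by
  have hv : (0 : ℝ) < N := by exact_mod_cast hN
  have hchern := measure_ge_le_exp_mul_mgf (μ := P) (t := (1 / 4) / N) ((4 * N : ℝ) ^ 2)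
    (by positivity) (hA.integrable_exp_normSq_mulVec hv hu (by norm_num))
  rw [hA.mgf_normSq_mulVec hv hu (by norm_num)] at hchern
  refine hchern.trans ?_
  have h2 : (√(1 - 2 * (1 / 4) : ℝ))⁻¹ ≤ Real.exp 1 := by
    have h12 : (1 / 2 : ℝ) ≤ √(1 - 2 * (1 / 4) : ℝ) := Real.le_sqrt_of_sq_le (by norm_num)
    calc (√(1 - 2 * (1 / 4) : ℝ))⁻¹ ≤ (1 / 2 : ℝ)⁻¹ := by gcongr
      _ ≤ Real.exp 1 := by linarith [Real.add_one_le_exp (1 : ℝ)]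
  calc Real.exp (-(1 / 4 / N) * (4 * N : ℝ) ^ 2) * (√(1 - 2 * (1 / 4) : ℝ))⁻¹ ^ M
      ≤ Real.exp (-4 * N) * Real.exp 1 ^ N := by
        gcongr ?_ * ?_
        · apply le_of_eq; congr 1; field_simp
        · exact (pow_le_pow_left₀ (by positivity) h2 M).trans
            (pow_le_pow_right₀ (Real.one_le_exp zero_le_one) hMN)
    _ = Real.exp (-3 * N) := by
        rw [← Real.exp_nat_mul, ← Real.exp_add]; congr 1; ring

end IsStdGaussianMatrix

/-! ### Rounding signals of small total variation to integer signals -/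

lemma exists_int_round_toward_zero (r : ℝ) :
    ∃ k : ℤ, |(k : ℝ)| + |r - k| ≤ |r| ∧ |r - k| ≤ 1 := by
  rcases le_total 0 r with hr | hr
  · refine ⟨⌊r⌋, ?_⟩
    have h0 : (0 : ℝ) ≤ ⌊r⌋ := by exact_mod_cast Int.floor_nonneg.2 hr
    have h1 := Int.floor_le r
    have h2 := Int.lt_floor_add_one r
    rw [abs_of_nonneg h0, abs_of_nonneg (sub_nonneg.2 h1), abs_of_nonneg hr]
    constructor <;> linarith
  · refine ⟨⌈r⌉, ?_⟩
    have h0 : (⌈r⌉ : ℝ) ≤ 0 := by exact_mod_cast Int.ceil_le.2 (by simpa using hr)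
    have h1 := Int.le_ceil r
    have h2 := Int.ceil_lt_add_one r
    rw [abs_of_nonpos h0, abs_of_nonpos (sub_nonpos.2 h1), abs_of_nonpos hr]
    constructor <;> linarith

/-- A real sequence is within distance `1` of an integer sequence whose increments, the first one
counted from `0`, have no larger total variation. The integer sequence moves towards the real one
by the integer part of the current discrepancy, so that increments and discrepancy telescope. -/
lemma exists_int_increments (g : ℕ → ℝ) :
    ∃ d : ℕ → ℤ, (∀ i, |g i - ∑ j ∈ Finset.range (i + 1), (d j : ℝ)| ≤ 1) ∧
      ∀ n, ∑ i ∈ Finset.range (n + 1), |(d i : ℝ)| ≤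
        |g 0| + ∑ i ∈ Finset.range n, |g (i + 1) - g i| := by
  choose T hT1 hT2 using exists_int_round_toward_zero
  obtain ⟨q, hq0, hq⟩ : ∃ q : ℕ → ℤ, q 0 = 0 ∧ ∀ i, q (i + 1) = q i + T (g i - (q i : ℝ)) :=
    ⟨fun n => Nat.rec (motive := fun _ => ℤ) 0 (fun i k => k + T (g i - (k : ℝ))) n, rfl,
      fun _ => rfl⟩
  have hsum (n : ℕ) : ∑ j ∈ Finset.range n, (T (g j - q j) : ℝ) = q n := by
    induction n with
    | zero => simp [hq0]
    | succ n ih => rw [Finset.sum_range_succ, ih, hq]; push_cast; ring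
  refine ⟨fun i => T (g i - q i), fun i => ?_, fun n => ?_⟩
  · rw [hsum, hq]
    have := hT2 (g i - q i)
    push_cast
    rwa [← sub_sub]
  · suffices h : ∑ i ∈ Finset.range (n + 1), |(T (g i - q i) : ℝ)| + |g n - q (n + 1)| ≤
        |g 0| + ∑ i ∈ Finset.range n, |g (i + 1) - g i| by
      linarith [abs_nonneg (g n - q (n + 1))]
    have hstep (i : ℕ) : |(T (g i - q i) : ℝ)| + |g i - q (i + 1)| ≤ |g i - q i| := by
      have := hT1 (g i - q i)
      rw [hq]
      push_cast
      rwa [← sub_sub]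
    induction n with
    | zero => simpa [hq0] using hstep 0
    | succ n ih =>
      rw [Finset.sum_range_succ, Finset.sum_range_succ (fun i => |g (i + 1) - g i|)]
      have h1 := hstep (n + 1)
      have h2 := abs_sub_le (g (n + 1)) (g n) (q (n + 1))
      linarith

/-- The integer vectors of length `N` whose `ℓ¹` norm is at most `L`. -/
noncomputable def intL1Ball (N L : ℕ) : Finset (Fin N → ℤ) :=
  {d ∈ Fintype.piFinset fun _ => Finset.Icc (-L : ℤ) L | ∑ i, (d i).natAbs ≤ L}

lemma mem_intL1Ball {N L : ℕ} {d : Fin N → ℤ} :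
    d ∈ intL1Ball N L ↔ ∑ i, (d i).natAbs ≤ L := by
  simp only [intL1Ball, Finset.mem_filter, Fintype.mem_piFinset, Finset.mem_Icc,
    and_iff_right_iff_imp]
  intro h i
  have := (Finset.single_le_sum (f := fun i => (d i).natAbs) (fun _ _ => Nat.zero_le _)
    (Finset.mem_univ i)).trans h
  omega

lemma sum_pow_natAbs_le {t : ℝ} (ht0 : 0 ≤ t) (ht : t ≤ 1 / 2) (L : ℕ) :
    ∑ k ∈ Finset.Icc (-L : ℤ) L, t ^ k.natAbs ≤ Real.exp (4 * t) := by
  have hgeom (n : ℕ) : ∑ k ∈ Finset.range n, t ^ k ≤ (1 - t)⁻¹ := by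
    rw [← tsum_geometric_of_lt_one ht0 (by linarith)]
    exact (summable_geometric_of_lt_one ht0 (by linarith)).sum_le_tsum _ fun _ _ => by positivity
  have hsub : Finset.Icc (-L : ℤ) L ⊆
      (Finset.range (L + 1)).image (fun k : ℕ => (k : ℤ)) ∪
        (Finset.range L).image (fun k : ℕ => -(k : ℤ) - 1) := by
    intro k hk
    rw [Finset.mem_Icc] at hk
    simp only [Finset.mem_union, Finset.mem_image, Finset.mem_range]
    rcases le_or_gt 0 k with h | h
    · exact Or.inl ⟨k.toNat, by omega, by omega⟩
    · exact Or.inr ⟨(-k - 1).toNat, by omega, by omega⟩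
  have hinv : (1 - t)⁻¹ ≤ 1 + 2 * t := by
    rw [inv_le_iff_one_le_mul₀ (by linarith)]
    nlinarith
  have hneg (k : ℕ) : t ^ (-(k : ℤ) - 1).natAbs = t ^ k * t := by
    rw [← pow_succ]; congr 1; omega
  calc ∑ k ∈ Finset.Icc (-L : ℤ) L, t ^ k.natAbs
      ≤ ∑ k ∈ (Finset.range (L + 1)).image (fun k : ℕ => (k : ℤ)) ∪
          (Finset.range L).image (fun k : ℕ => -(k : ℤ) - 1), t ^ k.natAbs :=
        Finset.sum_le_sum_of_subset_of_nonneg hsub fun _ _ _ => by positivity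
    _ ≤ ∑ k ∈ (Finset.range (L + 1)).image (fun k : ℕ => (k : ℤ)), t ^ k.natAbs +
          ∑ k ∈ (Finset.range L).image (fun k : ℕ => -(k : ℤ) - 1), t ^ k.natAbs := by
        rw [← Finset.sum_union_inter]
        exact le_add_of_nonneg_right (Finset.sum_nonneg fun _ _ => by positivity)
    _ = ∑ k ∈ Finset.range (L + 1), t ^ k + (∑ k ∈ Finset.range L, t ^ k) * t := by
        rw [Finset.sum_image (fun a _ b _ h => by simpa using h),
          Finset.sum_image (fun a _ b _ h => by simpa using h), Finset.sum_mul]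
        simp [hneg]
    _ ≤ (1 + 2 * t) + (1 + 2 * t) * t := by
        gcongr <;> exact (hgeom _).trans hinv
    _ ≤ 1 + 4 * t := by nlinarith
    _ ≤ Real.exp (4 * t) := by linarith [Real.add_one_le_exp (4 * t)]

lemma card_intL1Ball_mul_pow_le {t : ℝ} (ht0 : 0 ≤ t) (ht : t ≤ 1 / 2) (N L : ℕ) :
    (intL1Ball N L).card * t ^ L ≤ Real.exp (4 * t * N) := by
  calc ((intL1Ball N L).card : ℝ) * t ^ L = ∑ _d ∈ intL1Ball N L, t ^ L := by simp
    _ ≤ ∑ d ∈ intL1Ball N L, ∏ i, t ^ (d i).natAbs := by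
        refine Finset.sum_le_sum fun d hd => ?_
        rw [Finset.prod_pow_eq_pow_sum]
        exact pow_le_pow_of_le_one ht0 (by linarith) (mem_intL1Ball.1 hd)
    _ ≤ ∑ d ∈ Fintype.piFinset fun _ : Fin N => Finset.Icc (-L : ℤ) L,
          ∏ i, t ^ (d i).natAbs :=
        Finset.sum_le_sum_of_subset_of_nonneg (Finset.filter_subset _ _) fun _ _ _ =>
          Finset.prod_nonneg fun _ _ => by positivity
    _ = (∑ k ∈ Finset.Icc (-L : ℤ) L, t ^ k.natAbs) ^ N := by
        rw [← Finset.prod_univ_sum (fun _ : Fin N => Finset.Icc (-L : ℤ) L)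
          fun _ k => t ^ k.natAbs]
        simp
    _ ≤ Real.exp (4 * t) ^ N :=
        pow_le_pow_left₀ (Finset.sum_nonneg fun _ _ => by positivity)
          (sum_pow_natAbs_le ht0 ht L) N
    _ = Real.exp (4 * t * N) := by rw [← Real.exp_nat_mul]; congr 1; ring

/-- The integer points of the `ℓ¹` ball of radius `s N` are exponentially few, with a rate that can
be made arbitrarily small by shrinking `s`. -/
lemma exists_card_intL1Ball_le {ψ : ℝ} (hψ : 0 < ψ) :
    ∃ s : ℝ, 0 < s ∧ ∀ N L : ℕ, (L : ℝ) ≤ s * N →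
      ((intL1Ball N L).card : ℝ) ≤ Real.exp (ψ * N) := by
  obtain ⟨t, ht0, ht, htψ⟩ : ∃ t : ℝ, 0 < t ∧ t ≤ 1 / 2 ∧ 8 * t ≤ ψ :=
    ⟨min (1 / 2) (ψ / 8), by positivity, min_le_left _ _,
      by linarith [min_le_right (1 / 2) (ψ / 8)]⟩
  have hlog : Real.log t < 0 := Real.log_neg ht0 (by linarith)
  refine ⟨ψ / (2 * -Real.log t), div_pos hψ (by linarith), fun N L hL => ?_⟩
  have h := card_intL1Ball_mul_pow_le ht0.le ht N L
  have hpow : Real.exp (-(ψ / 2 * N)) ≤ t ^ L := by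
    rw [← Real.exp_log (pow_pos ht0 L), Real.log_pow, Real.exp_le_exp]
    have := mul_le_mul_of_nonneg_right hL (by linarith : 0 ≤ -Real.log t)
    have h2 : ψ / (2 * -Real.log t) * N * -Real.log t = ψ / 2 * N := by
      have := hlog.ne
      field_simp
    linarith
  have h3 : ((intL1Ball N L).card : ℝ) * Real.exp (-(ψ / 2 * N)) ≤ Real.exp (ψ / 2 * N) :=
    (mul_le_mul_of_nonneg_left hpow (by positivity)).trans (h.trans (Real.exp_le_exp.2 (by
      have : (0 : ℝ) ≤ N := by positivity
      nlinarith)))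
  rw [Real.exp_neg, ← div_eq_mul_inv, div_le_iff₀ (Real.exp_pos _), ← Real.exp_add] at h3
  convert! h3 using 2
  ring

/-- The vector of partial sums of an integer vector, that is, the integer signal whose increments
(the first one counted from `0`) are the entries of `d`. -/
def partialSums {N : ℕ} (d : Fin N → ℤ) (i : Fin N) : ℝ :=
  ∑ j ∈ Finset.Iic i, (d j : ℝ)

lemma exists_partialSums_close {N L : ℕ} (hN : 0 < N) (g : EuclideanSpace ℝ (Fin N))
    (hg : |g ⟨0, hN⟩| + tvNorm g ≤ L) :
    ∃ d ∈ intL1Ball N L, ∀ i, |g i - partialSums d i| ≤ 1 := by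
  obtain ⟨n, rfl⟩ : ∃ n, N = n + 1 := ⟨N - 1, by omega⟩
  let G : ℕ → ℝ := fun i => if h : i < n + 1 then g ⟨i, h⟩ else 0
  obtain ⟨d, hd1, hd2⟩ := exists_int_increments G
  refine ⟨fun i => d i, mem_intL1Ball.2 ?_, fun i => ?_⟩
  · have h := hd2 n
    have htv : ∑ i ∈ Finset.range n, |G (i + 1) - G i| = tvNorm g := by
      rw [Finset.sum_range]
      refine Finset.sum_congr rfl fun i _ => ?_
      have h1 : (i : ℕ) < n := i.2
      simp [G, finiteDiff, h1, h1.le]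
    have h0 : G 0 = g ⟨0, hN⟩ := by simp [G]
    rw [htv, h0, Finset.sum_range] at h
    have h' := h.trans hg
    have : ((∑ i : Fin (n + 1), (d i).natAbs : ℕ) : ℝ) ≤ L := by
      push_cast [Nat.cast_natAbs]
      exact_mod_cast h'
    exact_mod_cast this
  · have h := hd1 i
    have hG : G i = g i := dif_pos i.2
    have hs : partialSums (fun i : Fin (n + 1) => d i) i =
        ∑ j ∈ Finset.range (i + 1), (d j : ℝ) := by
      refine Finset.sum_bij (fun j _ => (j : ℕ)) ?_ ?_ ?_ ?_
      · intro j hj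
        simpa [Nat.lt_succ_iff] using hj
      · intro a _ b _ h
        exact Fin.ext h
      · intro b hb
        rw [Finset.mem_range] at hb
        exact ⟨⟨b, by omega⟩, by simp [Fin.le_def]; omega, rfl⟩
      · simp
    rwa [hs, ← hG]

/-! ### Injectivity of Gaussian matrices on signals of small total variation -/

lemma norm_sq_toEuclideanLin {M N : ℕ} (A : Matrix (Fin M) (Fin N) ℝ) (u : Fin N → ℝ) :
    ‖Matrix.toEuclideanLin A (WithLp.toLp 2 u)‖ ^ 2 = ∑ i, A.mulVec u i ^ 2 := by
  simp [EuclideanSpace.norm_sq_eq]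

/-- The vectors of length `N` with entries `±1`. -/
noncomputable def signVectors (N : ℕ) : Finset (Fin N → ℝ) :=
  Fintype.piFinset fun _ => {-1, 1}

lemma card_signVectors (N : ℕ) : (signVectors N).card = 2 ^ N := by
  have : (-1 : ℝ) ≠ 1 := by norm_num
  simp [signVectors, Finset.card_pair this]

lemma sum_sq_of_mem_signVectors {N : ℕ} {s : Fin N → ℝ} (hs : s ∈ signVectors N) :
    ∑ i, s i ^ 2 = N := by
  have h (i) : s i ^ 2 = 1 := by
    have := Fintype.mem_piFinset.1 hs i
    simp only [Finset.mem_insert, Finset.mem_singleton] at this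
    rcases this with h | h <;> simp [h]
  simp [h]

/-- On the cube `[-1, 1] ^ N` the convex function `e ↦ ‖A e‖` is dominated by its values at the
vertices. -/
lemma exists_signVector_norm_le {M N : ℕ} (A : Matrix (Fin M) (Fin N) ℝ) {e : Fin N → ℝ}
    (he : ∀ i, |e i| ≤ 1) :
    ∃ s ∈ signVectors N, ‖Matrix.toEuclideanLin A (WithLp.toLp 2 e)‖ ≤
      ‖Matrix.toEuclideanLin A (WithLp.toLp 2 s)‖ := by
  have hconv : ConvexOn ℝ Set.univ
      fun u : Fin N → ℝ => ‖Matrix.toEuclideanLin A (WithLp.toLp 2 u)‖ :=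
    convexOn_univ_norm.comp_linearMap
      (Matrix.toEuclideanLin A ∘ₗ (WithLp.linearEquiv 2 ℝ (Fin N → ℝ)).symm.toLinearMap)
  have hmem : e ∈ convexHull ℝ (Set.univ.pi fun _ : Fin N => ({-1, 1} : Set ℝ)) := by
    refine mem_convexHull_pi fun i _ => ?_
    rw [convexHull_pair, segment_eq_Icc (by norm_num)]
    exact abs_le.1 (he i)
  obtain ⟨s, hs, hle⟩ := hconv.exists_ge_of_mem_convexHull (Set.subset_univ _) hmem
  exact ⟨s, by simpa [signVectors] using hs, hle⟩

/-- The event on which the recovery guarantee holds: `‖A q‖ ≥ (√M / 2) ‖q‖` for all integer signals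
`q` with increments in the `ℓ¹` ball of radius `L`, and `‖A s‖ < 4 N` for all vertices `s` of the
cube `[-1, 1] ^ N`. -/
structure WellConditionedOnNet {M N : ℕ} (L : ℕ) (A : Matrix (Fin M) (Fin N) ℝ) : Prop where
  lower : ∀ d ∈ intL1Ball N L,
    M / 4 * ∑ j, partialSums d j ^ 2 ≤ ∑ i, A.mulVec (partialSums d) i ^ 2
  upper : ∀ s ∈ signVectors N, ∑ i, A.mulVec s i ^ 2 < (4 * N : ℝ) ^ 2

lemma IsStdGaussianMatrix.measure_not_wellConditionedOnNet_le {Ω : Type*} [MeasurableSpace Ω]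
    {P : Measure Ω} [IsProbabilityMeasure P] {M N : ℕ} {A : Ω → Matrix (Fin M) (Fin N) ℝ}
    (hA : IsStdGaussianMatrix A P) (hMN : M ≤ N) (hN : 0 < N) (L : ℕ) :
    P.real {ω | ¬ WellConditionedOnNet L (A ω)} ≤
      (intL1Ball N L).card * Real.exp (-(M / 4)) + Real.exp (-N) := by
  have hsub : {ω | ¬ WellConditionedOnNet L (A ω)} ⊆
      (⋃ d ∈ intL1Ball N L, {ω | ∑ i, (A ω).mulVec (partialSums d) i ^ 2 <
        M / 4 * ∑ j, partialSums d j ^ 2}) ∪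
      ⋃ s ∈ signVectors N, {ω | (4 * N : ℝ) ^ 2 ≤ ∑ i, (A ω).mulVec s i ^ 2} := by
    intro ω hω
    by_contra hcon
    simp only [Set.mem_union, Set.mem_iUnion, Set.mem_ofPred_eq, not_or, not_exists, not_lt,
      not_le] at hcon
    exact hω ⟨hcon.1, hcon.2⟩
  refine (measureReal_mono hsub).trans ((measureReal_union_le _ _).trans (add_le_add ?_ ?_))
  · refine (measureReal_biUnion_finset_le _ _).trans ?_
    refine (Finset.sum_le_sum fun d _ => hA.measure_normSq_mulVec_lt (partialSums d)).trans ?_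
    simp
  · refine (measureReal_biUnion_finset_le _ _).trans ?_
    refine (Finset.sum_le_sum fun s hs =>
      hA.measure_le_normSq_mulVec hMN (sum_sq_of_mem_signVectors hs) hN).trans ?_
    rw [Finset.sum_const, card_signVectors, nsmul_eq_mul, Nat.cast_pow, Nat.cast_ofNat]
    calc (2 : ℝ) ^ N * Real.exp (-3 * N) ≤ Real.exp 1 ^ N * Real.exp (-3 * N) := by
          gcongr
          linarith [Real.add_one_le_exp (1 : ℝ)]
      _ = Real.exp (-2 * N) := by
          rw [← Real.exp_nat_mul, ← Real.exp_add]; congr 1; ring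
      _ ≤ Real.exp (-N) := by
          rw [Real.exp_le_exp]
          have : (0 : ℝ) ≤ N := by positivity
          linarith

lemma tvNorm_smul {N : ℕ} (c : ℝ) (x : EuclideanSpace ℝ (Fin N)) :
    tvNorm (c • x) = |c| * tvNorm x := by
  simp [tvNorm, finiteDiff, ← mul_sub, abs_mul, Finset.mul_sum]

/-- On the event `WellConditionedOnNet`, the matrix `A` is bounded below on signals whose total
variation is small compared with `√N` times their norm. The signal is scaled to norm `√N / η` and
rounded to an integer signal `q`, on which `A` is bounded below; the rounding error lies in the cube
and costs at most `(c + 4) N`, of which `c N` comes from `‖q‖` being smaller than `√N / η`. -/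
lemma WellConditionedOnNet.le_norm {M N L : ℕ} {A : Matrix (Fin M) (Fin N) ℝ}
    (hA : WellConditionedOnNet L A) {c η s : ℝ} (hc : 0 < c) (hη : η = c / (2 * (c + 4)))
    (hN : 0 < N) (hM : c ^ 2 * N ≤ M / 4) (hL : s * N ≤ L) (hNs : √N / η ≤ s / 2 * N)
    (h : EuclideanSpace ℝ (Fin N)) (htv : tvNorm h ≤ s * η / 2 * √N * ‖h‖) :
    c / 2 * √N * ‖h‖ ≤ ‖Matrix.toEuclideanLin A h‖ := by
  rcases eq_or_ne h 0 with rfl | hh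
  · simp
  have hη0 : 0 < η := by rw [hη]; positivity
  have hN' : (0 : ℝ) < N := by exact_mod_cast hN
  have hsqrt : 0 < √(N : ℝ) := Real.sqrt_pos.2 hN'
  have hsq : √(N : ℝ) * √N = N := Real.mul_self_sqrt hN'.le
  have hh' : 0 < ‖h‖ := norm_pos_iff.2 hh
  set a := √N / (η * ‖h‖) with ha
  have ha0 : 0 < a := by positivity
  set g := a • h with hg
  have hnorm : ‖g‖ = √N / η := by
    rw [hg, norm_smul, Real.norm_of_nonneg ha0.le, ha]; field_simp
  have hgL : |g ⟨0, hN⟩| + tvNorm g ≤ L := by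
    have h1 : |g ⟨0, hN⟩| ≤ s / 2 * N := by
      refine le_trans ?_ hNs
      rw [← hnorm, ← Real.norm_eq_abs]
      exact PiLp.norm_apply_le g _
    have h2 : tvNorm g ≤ s / 2 * N := by
      rw [hg, tvNorm_smul, abs_of_pos ha0]
      calc a * tvNorm h ≤ a * (s * η / 2 * √N * ‖h‖) := by gcongr
        _ = s / 2 * (√N * √N) := by rw [ha]; field_simp
        _ = s / 2 * N := by rw [hsq]
    linarith
  obtain ⟨d, hd, hclose⟩ := exists_partialSums_close hN g hgL
  set q : EuclideanSpace ℝ (Fin N) := WithLp.toLp 2 (partialSums d) with hq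
  have hdiff : ‖g - q‖ ≤ √N := by
    rw [EuclideanSpace.norm_eq]
    refine Real.sqrt_le_sqrt ?_
    calc ∑ i, ‖(g - q) i‖ ^ 2 ≤ ∑ _i : Fin N, (1 : ℝ) := by
          refine Finset.sum_le_sum fun i _ => ?_
          exact pow_le_one₀ (norm_nonneg _) (hclose i)
      _ = N := by simp
  have hqlow : c * √N * ‖q‖ ≤ ‖Matrix.toEuclideanLin A q‖ := by
    refine le_of_sq_le_sq ?_ (norm_nonneg _)
    rw [hq, norm_sq_toEuclideanLin, mul_pow, mul_pow, Real.sq_sqrt hN'.le,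
      EuclideanSpace.norm_sq_eq]
    refine le_trans ?_ (hA.lower d hd)
    simp only [Real.norm_eq_abs, sq_abs]
    gcongr
  have herr : ‖Matrix.toEuclideanLin A (g - q)‖ ≤ 4 * N := by
    obtain ⟨σ, hσ, hle⟩ := exists_signVector_norm_le A (e := fun i => g i - partialSums d i) hclose
    refine hle.trans (le_of_sq_le_sq ?_ (by positivity))
    rw [norm_sq_toEuclideanLin]
    exact (hA.upper σ hσ).le
  have hAg : ‖Matrix.toEuclideanLin A g‖ = a * ‖Matrix.toEuclideanLin A h‖ := by
    rw [hg, map_smul, norm_smul, Real.norm_of_nonneg ha0.le]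
  have h1 : ‖Matrix.toEuclideanLin A q‖ ≤
      ‖Matrix.toEuclideanLin A g‖ + ‖Matrix.toEuclideanLin A (g - q)‖ := by
    rw [map_sub]
    exact norm_le_insert _ _
  have h2 : √N / η - √N ≤ ‖q‖ := by
    have h3 := norm_sub_norm_le g q
    linarith
  have h3 : c * √N * (√N / η - √N) ≤ a * ‖Matrix.toEuclideanLin A h‖ + 4 * N := by
    rw [← hAg]
    have : c * √N * (√N / η - √N) ≤ c * √N * ‖q‖ := by gcongr
    linarith
  have h4 : c * √N * (√N / η - √N) = c / η * N - c * N := by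
    calc c * √N * (√N / η - √N) = (c / η - c) * (√N * √N) := by ring
      _ = c / η * N - c * N := by rw [hsq]; ring
  -- the choice of `η` makes the rounding loss half of the main term
  have h5 : c / η = 2 * (c + 4) := by rw [hη]; field_simp
  have h6 : (c + 4) * N ≤ a * ‖Matrix.toEuclideanLin A h‖ := by
    rw [h4, h5] at h3; linarith
  have h7 : a * (c / 2 * √N * ‖h‖) = (c + 4) * N := by
    rw [ha, hη]; field_simp; rw [sq, hsq]
  exact le_of_mul_le_mul_left (h7.trans_le h6) ha0

/-! ### From injectivity to recovery -/

lemma sum_sq_finiteDiff_le {N : ℕ} (x : EuclideanSpace ℝ (Fin N)) :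
    ∑ i, finiteDiff x i ^ 2 ≤ (2 * ‖x‖) ^ 2 := by
  have hinj (e : Fin (N - 1) → Fin N) (he : Function.Injective e) : ∑ i, x (e i) ^ 2 ≤ ‖x‖ ^ 2 := by
    rw [EuclideanSpace.norm_sq_eq]
    simp only [Real.norm_eq_abs, sq_abs]
    exact (Finset.sum_map Finset.univ ⟨e, he⟩ fun j => x j ^ 2).symm.trans_le
      (Finset.sum_le_univ_sum_of_nonneg fun _ => sq_nonneg _)
  have h1 := hinj (fun i => ⟨i.val + 1, by omega⟩) fun a b h => by simpa [Fin.ext_iff] using h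
  have h2 := hinj (fun i => ⟨i.val, by omega⟩) fun a b h => by simpa [Fin.ext_iff] using h
  calc ∑ i, finiteDiff x i ^ 2
      ≤ ∑ i : Fin (N - 1), (2 * x ⟨i.val + 1, by omega⟩ ^ 2 + 2 * x ⟨i.val, by omega⟩ ^ 2) := by
        refine Finset.sum_le_sum fun i _ => ?_
        rw [finiteDiff]
        nlinarith [sq_nonneg (x ⟨i.val + 1, by omega⟩ + x ⟨i.val, by omega⟩)]
    _ ≤ (2 * ‖x‖) ^ 2 := by
        rw [Finset.sum_add_distrib, ← Finset.mul_sum, ← Finset.mul_sum]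
        nlinarith

lemma sum_abs_finiteDiff_le {N : ℕ} (x : EuclideanSpace ℝ (Fin N)) (K : Finset (Fin (N - 1))) :
    ∑ i ∈ K, |finiteDiff x i| ≤ √K.card * (2 * ‖x‖) := by
  refine le_of_sq_le_sq ?_ (by positivity)
  rw [mul_pow, Real.sq_sqrt (by positivity)]
  refine sq_sum_le_card_mul_sum_sq.trans ?_
  gcongr
  simp only [sq_abs]
  exact (Finset.sum_le_univ_sum_of_nonneg fun _ => sq_nonneg _).trans (sum_sq_finiteDiff_le x)

/-- If `z` has no larger total variation than `x`, then the gradient of `x - z` is concentrated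
on `K` up to the gradient of `x` off `K`. -/
lemma tvNorm_sub_le {N : ℕ} {x z : EuclideanSpace ℝ (Fin N)} (h : tvNorm z ≤ tvNorm x)
    (K : Finset (Fin (N - 1))) :
    tvNorm (x - z) ≤ 2 * ∑ i ∈ K, |finiteDiff (x - z) i| + 2 * ∑ i ∈ Kᶜ, |finiteDiff x i| := by
  have hD (i) : finiteDiff (x - z) i = finiteDiff x i - finiteDiff z i := by
    simp [finiteDiff]; ring
  have h1 : ∑ i ∈ K, |finiteDiff x i| ≤
      ∑ i ∈ K, |finiteDiff z i| + ∑ i ∈ K, |finiteDiff (x - z) i| := by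
    rw [← Finset.sum_add_distrib]
    refine Finset.sum_le_sum fun i _ => ?_
    rw [hD]
    linarith [abs_sub_abs_le_abs_sub (finiteDiff x i) (finiteDiff z i)]
  have h2 : ∑ i ∈ Kᶜ, |finiteDiff (x - z) i| ≤
      ∑ i ∈ Kᶜ, |finiteDiff x i| + ∑ i ∈ Kᶜ, |finiteDiff z i| := by
    rw [← Finset.sum_add_distrib]
    refine Finset.sum_le_sum fun i _ => ?_
    rw [hD]
    exact abs_sub _ _
  unfold tvNorm at h ⊢
  rw [← Finset.sum_add_sum_compl K] at h ⊢
  rw [← Finset.sum_add_sum_compl K fun i => |finiteDiff x i|] at h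
  linarith

lemma exists_bestGradientError_eq {N : ℕ} {s : ℝ} (hs : 0 ≤ s) (x : EuclideanSpace ℝ (Fin N)) :
    ∃ K : Finset (Fin (N - 1)), (K.card : ℝ) ≤ s ∧
      bestGradientError s x = ∑ i ∈ Kᶜ, |finiteDiff x i| := by
  have : Nonempty {K : Finset (Fin (N - 1)) // (K.card : ℝ) ≤ s} := ⟨⟨∅, by simpa using hs⟩⟩
  obtain ⟨K, hK⟩ := exists_eq_ciInf_of_finite
    (f := fun K : {K : Finset (Fin (N - 1)) // (K.card : ℝ) ≤ s} =>
      ∑ i ∈ (K.val)ᶜ, |finiteDiff x i|)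
  exact ⟨K.val, K.2, hK.symm⟩

/-- A lower bound for `A` on signals of small total variation implies robust recovery: the
difference of the signal and a solution either has small total variation, or is controlled by the
best gradient error. -/
lemma robustTVRecovery_of_le_norm {M N : ℕ} {A : Matrix (Fin M) (Fin N) ℝ} {C γ κ : ℝ}
    (hC0 : 0 < C) (hC1 : C < 1) (hγ : 0 < γ) (hκ : 0 < κ) (hMN : M < N)
    (hA : ∀ h : EuclideanSpace ℝ (Fin N), tvNorm h ≤ γ * √N * ‖h‖ →
      κ * √N * ‖h‖ ≤ ‖Matrix.toEuclideanLin A h‖) :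
    RobustTVRecovery C ((γ / 8) ^ 2) (min (γ / 2) (2 * κ)) A := by
  intro x y ε hx z hz
  have hε : 0 ≤ ε := (norm_nonneg _).trans hx
  have hN : (0 : ℝ) < N := by exact_mod_cast (Nat.zero_le M).trans_lt hMN
  have hN' : 0 < √(N : ℝ) := Real.sqrt_pos.2 hN
  obtain ⟨K, hK, hKeq⟩ := exists_bestGradientError_eq (s := (γ / 8) ^ 2 * N) (by positivity) x
  set σ := bestGradientError ((γ / 8) ^ 2 * N) x
  have hσ : 0 ≤ σ := by rw [hKeq]; positivity
  have hsub : 0 < √(N : ℝ) - √M :=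
    sub_pos.2 (Real.sqrt_lt_sqrt (by positivity) (by exact_mod_cast hMN))
  set β := min (γ / 2) (2 * κ)
  have hβ : 0 < β := lt_min (by positivity) (by positivity)
  have hfac : 1 / β ≤ (1 + C) / (β * (1 - C)) := by
    have : 0 < 1 - C := by linarith
    rw [div_le_div_iff₀ hβ (by positivity)]
    nlinarith
  have hs1 : 0 ≤ σ / √N := by positivity
  have hs2 : 0 ≤ ε / (√N - √M) := by positivity
  -- the two terms of the bound dominate the two cases of the argument
  suffices hmain : ‖x - z‖ ≤ 2 / β * (σ / √N) ∨ ‖x - z‖ ≤ 4 / β * (ε / (√N - √M)) by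
    have e1 : 2 / β ≤ 2 * (1 + C) / (β * (1 - C)) := by
      rw [mul_div_assoc]; linarith [show 2 / β = 2 * (1 / β) by ring]
    have e2 : 4 / β ≤ 2 + 4 * (1 + C) / (β * (1 - C)) := by
      rw [mul_div_assoc]; linarith [show 4 / β = 4 * (1 / β) by ring]
    have f1 := mul_le_mul_of_nonneg_right e1 hs1
    have f2 := mul_le_mul_of_nonneg_right e2 hs2
    have g1 : 0 ≤ 2 / β * (σ / √N) := by positivity
    have g2 : 0 ≤ 4 / β * (ε / (√N - √M)) := by positivity
    rcases hmain with h | h <;> linarith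
  have htv : tvNorm (x - z) ≤ γ / 2 * √N * ‖x - z‖ + 2 * σ := by
    have h1 := tvNorm_sub_le (hz.2 hx) K
    have h2 := sum_abs_finiteDiff_le (x - z) K
    have h3 : √(K.card : ℝ) ≤ γ / 8 * √N := by
      refine (Real.sqrt_le_sqrt hK).trans_eq ?_
      rw [Real.sqrt_mul (by positivity), Real.sqrt_sq (by positivity)]
    have h4 := mul_le_mul_of_nonneg_right h3 (by positivity : 0 ≤ 2 * ‖x - z‖)
    rw [← hKeq] at h1
    linarith
  rcases le_total (2 * σ) (γ / 2 * √N * ‖x - z‖) with hcase | hcase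
  · right
    have hlow := hA (x - z) (by linarith)
    have hup : ‖Matrix.toEuclideanLin A (x - z)‖ ≤ 2 * ε := by
      have h1 := norm_sub_le (Matrix.toEuclideanLin A x - y) (Matrix.toEuclideanLin A z - y)
      have h2 : ‖Matrix.toEuclideanLin A z - y‖ ≤ ε := hz.1
      rw [sub_sub_sub_cancel_right, ← map_sub] at h1
      linarith
    have h1 : κ * (√N - √M) * ‖x - z‖ ≤ κ * √N * ‖x - z‖ := by
      gcongr
      linarith [Real.sqrt_nonneg (M : ℝ)]
    have h2 : ‖x - z‖ ≤ 4 / (2 * κ) * (ε / (√N - √M)) := by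
      rw [div_mul_div_comm, le_div_iff₀ (by positivity)]
      linarith
    refine h2.trans ?_
    gcongr
    exact min_le_right _ _
  · left
    have h2 : ‖x - z‖ ≤ 2 / (γ / 2) * (σ / √N) := by
      rw [div_mul_div_comm, le_div_iff₀ (by positivity)]
      linarith
    refine h2.trans ?_
    gcongr
    exact min_le_left _ _

/-! ### The recovery theorem -/

theorem mainTheorem4 (α : ℝ) (hα0 : 0 < α) (hα1 : α < 1) (C : ℝ) (hC0 : 0 < C) (hC1 : C < 1) :
    ∃ δ : ℝ, 0 < δ ∧ ∃ β : ℝ, 0 < β ∧ ∃ c : ℝ, 0 < c ∧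
      ∀ (M N : ℕ → ℕ), Tendsto M atTop atTop → Tendsto N atTop atTop →
        Tendsto (fun k => (M k : ℝ) / (N k : ℝ)) atTop (𝓝 α) →
        ∀ (Ω : ℕ → Type*) [∀ k, MeasurableSpace (Ω k)]
          (P : ∀ k, Measure (Ω k)) [∀ k, IsProbabilityMeasure (P k)]
          (A : ∀ k, Ω k → Matrix (Fin (M k)) (Fin (N k)) ℝ),
          (∀ k, IsStdGaussianMatrix (A k) (P k)) →
          ∀ᶠ k in atTop,
            P k {ω | ¬ RobustTVRecovery C δ β (A k ω)} ≤
              ENNReal.ofReal (Real.exp (-c * (N k : ℝ))) := by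
  -- the net has at most `exp (α N / 16)` points, each of which fails with probability at most
  -- `exp (-M / 4) ≤ exp (-α N / 8)`
  obtain ⟨s, hs, hcard⟩ := exists_card_intL1Ball_le (ψ := α / 16) (by positivity)
  set a := √(α / 8) with ha
  have ha0 : 0 < a := Real.sqrt_pos.2 (by positivity)
  set η := a / (2 * (a + 4)) with hη
  have hη0 : 0 < η := by positivity
  -- half of the radius `s N` absorbs the rounding of `s N` to an integer
  set r := s / 2 with hr
  have hr0 : 0 < r := by positivity
  set γ := r * η / 2 with hγ
  have hγ0 : 0 < γ := by positivity
  refine ⟨(γ / 8) ^ 2, by positivity, min (γ / 2) (2 * (a / 2)), by positivity, α / 32,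
    by positivity, ?_⟩
  intro M N _ hN hMN Ω _ P _ A hA
  have hNR : Tendsto (fun k => (N k : ℝ)) atTop atTop := tendsto_natCast_atTop_atTop.comp hN
  have hsqrt : Tendsto (fun k => √(N k : ℝ)) atTop atTop := Real.tendsto_sqrt_atTop.comp hNR
  filter_upwards [hN.eventually_gt_atTop 0, hMN.eventually_lt_const hα1,
    hMN.eventually_const_lt (half_lt_self hα0), hNR.eventually_ge_atTop (1 / r),
    hsqrt.eventually_ge_atTop (2 / (η * r)), hNR.eventually_ge_atTop (32 / α)]
    with k hk0 hk1 hk2 hk3 hk4 hk5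
  have hNk : (0 : ℝ) < N k := by exact_mod_cast hk0
  have hlt : M k < N k := by
    rw [div_lt_one hNk] at hk1
    exact_mod_cast hk1
  have hM : α / 2 * N k ≤ M k := ((lt_div_iff₀ hNk).1 hk2).le
  set L := ⌊s * N k⌋₊ with hL
  have hL1 : (L : ℝ) ≤ s * N k := Nat.floor_le (by positivity)
  have hL2 : r * N k ≤ L := by
    have h1 := Nat.lt_floor_add_one (s * N k)
    have h2 : 1 ≤ r * N k := by
      rw [div_le_iff₀ hr0] at hk3
      linarith
    have h3 : s * N k = r * N k + r * N k := by rw [hr]; ring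
    linarith
  have hNs : √(N k) / η ≤ r / 2 * N k := by
    rw [div_le_iff₀ (by positivity)] at hk4
    rw [div_le_iff₀ hη0]
    have h1 := mul_le_mul_of_nonneg_left hk4 (Real.sqrt_nonneg (N k))
    have h2 : √(N k : ℝ) * √(N k) = N k := Real.mul_self_sqrt hNk.le
    have h3 : √(N k : ℝ) * (√(N k) * (η * r)) = N k * (η * r) := by rw [← mul_assoc, h2]
    linarith
  have ha2 : a ^ 2 * N k ≤ M k / 4 := by
    rw [ha, Real.sq_sqrt (by positivity)]
    linarith
  have hsub : {ω | ¬ RobustTVRecovery C ((γ / 8) ^ 2) (min (γ / 2) (2 * (a / 2))) (A k ω)} ⊆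
      {ω | ¬ WellConditionedOnNet L (A k ω)} := fun ω hω hgood =>
    hω (robustTVRecovery_of_le_norm hC0 hC1 hγ0 (by positivity) hlt fun h hh =>
      hgood.le_norm ha0 hη hk0 ha2 hL2 hNs h hh)
  have hreal : (P k).real {ω | ¬ WellConditionedOnNet L (A k ω)} ≤
      Real.exp (-(α / 32) * N k) := by
    refine ((hA k).measure_not_wellConditionedOnNet_le hlt.le hk0 L).trans ?_
    have h1 : ((intL1Ball (N k) L).card : ℝ) * Real.exp (-(M k / 4)) ≤
        Real.exp (-(α / 16) * N k) := by
      calc ((intL1Ball (N k) L).card : ℝ) * Real.exp (-(M k / 4))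
          ≤ Real.exp (α / 16 * N k) * Real.exp (-(α / 8 * N k)) := by
            gcongr
            · exact hcard _ _ hL1
            · linarith
        _ = Real.exp (-(α / 16) * N k) := by rw [← Real.exp_add]; congr 1; ring
    have h2 : Real.exp (-(N k : ℝ)) ≤ Real.exp (-(α / 16) * N k) := by
      rw [Real.exp_le_exp]
      nlinarith
    have h3 : 2 ≤ Real.exp (α / 32 * N k) := by
      rw [div_le_iff₀ hα0] at hk5
      linarith [Real.add_one_le_exp (α / 32 * N k)]
    calc _ ≤ 2 * Real.exp (-(α / 16) * N k) := by linarith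
      _ ≤ Real.exp (α / 32 * N k) * Real.exp (-(α / 16) * N k) := by gcongr
      _ = Real.exp (-(α / 32) * N k) := by rw [← Real.exp_add]; congr 1; ring
  refine (measure_mono hsub).trans ?_
  rw [← ofReal_measureReal]
  exact ENNReal.ofReal_le_ofReal hreal
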